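/- Let $k$ be an algebraically closed field of characteristic zero, and let $X$ be an algebraic variety over $k$ (a reduced separated scheme of finite type over $k$, not necessarily irreducible). Suppose that $X$ is toral, i.e. that $X$ is isomorphic over $k$ to a closed subvariety of $\mathbf{A}^n\setminus\bigcup_{i=1}^n H_i$ for some integer $n\ge 0$, where $H_i$ is the set of zeros of the $i$-th standard coordinate function on $\mathbf{A}^n$. Then the group $\mathrm{Aut}(X)$ of automorphisms of $X$ over $k$ is Jordan: there exists a positive integer $d$, depending only on $\mathrm{Aut}(X)$, such that every finite subgroup $K$ of $\mathrm{Aut}(X)$ contains a normal abelian subgroup of $K$ whose index in $K$ is at most $d$. -/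

import Mathlib

open AlgebraicGeometry CategoryTheory

universe u

/-- A group `G` is Jordan if there is a positive integer `d` such that every finite subgroup `K`
of `G` contains a normal (in `K`) abelian subgroup of index at most `d` in `K`. -/
def IsJordanGroup (G : Type*) [Group G] : Prop :=
  ∃ d : ℕ, 0 < d ∧ ∀ K : Subgroup G, Finite K →
    ∃ A : Subgroup K, A.Normal ∧ (∀ a ∈ A, ∀ b ∈ A, a * b = b * a) ∧ A.index ≤ d

/-- A `k`-scheme is a variety if it is reduced, separated and of finite type over `k`;
it need be neither irreducible nor connected. Over an algebraically closed field the category of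
these is equivalent to that of algebraic varieties in the sense of Serre. -/
structure IsVarietyOver (k : Type u) [Field k] (X : Over (Spec (CommRingCat.of k))) : Prop where
  isReduced : AlgebraicGeometry.IsReduced X.left
  isSeparated : IsSeparated X.hom
  locallyOfFiniteType : LocallyOfFiniteType X.hom
  quasiCompact : QuasiCompact X.hom

/-- The open subset of affine `n`-space over `k` where no standard coordinate function vanishes,
that is, the complement of the union of the `n` coordinate hyperplanes. -/
noncomputable def coordTorusOpens (k : Type u) [Field k] (n : ℕ) :
    (AffineSpace (ULift.{u} (Fin n)) (Spec (CommRingCat.of k))).Opens :=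
  ⨅ i : ULift.{u} (Fin n), (AffineSpace (ULift.{u} (Fin n)) (Spec (CommRingCat.of k))).basicOpen
    (AffineSpace.coord (Spec (CommRingCat.of k)) i)

/-- The `n`-dimensional torus as a `k`-scheme: the open subscheme of affine `n`-space
complementary to the coordinate hyperplanes. -/
noncomputable def coordTorus (k : Type u) [Field k] (n : ℕ) : Over (Spec (CommRingCat.of k)) :=
  Over.mk ((coordTorusOpens k n).ι ≫
    (AffineSpace (ULift.{u} (Fin n)) (Spec (CommRingCat.of k)) ↘ Spec (CommRingCat.of k)))

/-- A variety `X` over `k` is toral if it is isomorphic to a closed subvariety of some torus,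
i.e. if it admits a closed immersion over `k` into a torus. -/
def IsToral (k : Type u) [Field k] (X : Over (Spec (CommRingCat.of k))) : Prop :=
  ∃ (n : ℕ) (i : X ⟶ coordTorus k n), IsClosedImmersion i.left

/-!
A closed subscheme `X` of a torus is affine and its algebra `A` of global sections is generated by
units, so `Aut X` embeds into `Aut_k A` and it suffices to treat the latter. It acts on the integral
closure `E` of `k` in `A`, which is finite-dimensional and reduced and therefore has only finitely
many automorphisms. It also acts on the quotient `Q` of the units of `A` by the units integral over
`k`, which is torsion-free and, by a theorem of Rosenlicht, finitely generated, so that the finite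
subgroups of `Aut Q` have bounded order by a theorem of Minkowski. Automorphisms `σ`, `τ` acting
trivially on both `E` and `Q` multiply each unit `u` by elements of `E` fixed by `σ` and `τ`. Hence
`σ` and `τ` commute on the units, which generate `A`.

Minkowski's theorem holds because an element of finite order in `GL_n(ℤ)` that is trivial modulo `3`
is trivial. Rosenlicht's theorem reduces to a domain `B`. By Noether normalization `B` is finite
over a polynomial ring `P`; an element of `B` that is also integral over the valuation ring of `P`
at infinity is integral over `k`, and only finitely many places of the fraction field of `B` lie
over infinity.
-/

/-! ### Bounded groups and Jordan groups -/

/-- The group `G` is bounded: the orders of its finite subgroups are bounded. Jordan groups arise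
here as extensions of bounded groups by abelian ones. -/
def HasBoundedFiniteSubgroups (G : Type*) [Group G] : Prop :=
  ∃ d : ℕ, ∀ K : Subgroup G, Finite K → Nat.card K ≤ d

namespace HasBoundedFiniteSubgroups

variable {G H : Type*} [Group G] [Group H]

theorem of_finite [Finite G] : HasBoundedFiniteSubgroups G :=
  ⟨Nat.card G, fun K _ => K.card_le_card_group⟩

theorem prod (hG : HasBoundedFiniteSubgroups G) (hH : HasBoundedFiniteSubgroups H) :
    HasBoundedFiniteSubgroups (G × H) := by
  obtain ⟨d, hd⟩ := hG
  obtain ⟨e, he⟩ := hH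
  refine ⟨d * e, fun K _ => ?_⟩
  have : Finite (K.map (MonoidHom.fst G H)) := Set.Finite.image _ (Set.toFinite (K : Set (G × H)))
  have : Finite (K.map (MonoidHom.snd G H)) := Set.Finite.image _ (Set.toFinite (K : Set (G × H)))
  let P := (K.map (MonoidHom.fst G H)).prod (K.map (MonoidHom.snd G H))
  have e' : P ≃* K.map (MonoidHom.fst G H) × K.map (MonoidHom.snd G H) := Subgroup.prodEquiv ..
  have : Finite P := .of_equiv _ e'.symm.toEquiv
  calc Nat.card K ≤ Nat.card P := Subgroup.card_le_of_le (Subgroup.le_prod_iff.2 ⟨le_rfl, le_rfl⟩)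
    _ = _ := (Nat.card_congr e'.toEquiv).trans (Nat.card_prod ..)
    _ ≤ d * e := Nat.mul_le_mul (hd _ ‹_›) (he _ ‹_›)

theorem of_ker_torsionFree (hH : HasBoundedFiniteSubgroups H) (f : G →* H)
    (hf : ∀ g ∈ f.ker, IsOfFinOrder g → g = 1) : HasBoundedFiniteSubgroups G := by
  obtain ⟨d, hd⟩ := hH
  refine ⟨d, fun K _ => ?_⟩
  have hinj : Function.Injective (f.comp K.subtype) := by
    refine (injective_iff_map_eq_one _).2 fun g hg => Subtype.ext ?_
    exact hf g hg (Submonoid.isOfFinOrder_coe.2 (isOfFinOrder_of_finite g))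
  rw [Nat.card_congr (MonoidHom.ofInjective hinj).toEquiv]
  exact hd _ (Set.finite_range _)

theorem isJordanGroup_of_ker_comm (hH : HasBoundedFiniteSubgroups H) (f : G →* H)
    (hf : ∀ a ∈ f.ker, ∀ b ∈ f.ker, a * b = b * a) : IsJordanGroup G := by
  obtain ⟨d, hd⟩ := hH
  refine ⟨d, Nat.card_pos.trans_le (hd ⊥ inferInstance), fun K _ => ?_⟩
  let φ := f.comp K.subtype
  refine ⟨φ.ker, inferInstance, fun a ha b hb => Subtype.ext (hf a ha b hb), ?_⟩
  rw [Subgroup.index_ker]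
  exact hd φ.range (Set.finite_range φ)

end HasBoundedFiniteSubgroups

theorem IsJordanGroup.of_injective {G H : Type*} [Group G] [Group H] (hH : IsJordanGroup H)
    (f : G →* H) (hf : Function.Injective f) : IsJordanGroup G := by
  obtain ⟨d, hd, h⟩ := hH
  refine ⟨d, hd, fun K _ => ?_⟩
  let e : K ≃* K.map f := K.equivMapOfInjective f hf
  obtain ⟨A, hA, hcomm, hindex⟩ := h (K.map f) (Finite.of_equiv K e.toEquiv)
  refine ⟨A.comap e.toMonoidHom, inferInstance, fun a ha b hb => e.injective ?_, ?_⟩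
  · simpa using hcomm _ ha _ hb
  · rwa [Subgroup.index_comap_of_surjective _ e.surjective]

/-! ### Minkowski's theorem -/

theorem exists_one_add_pow_eq {S : Type*} [CommRing S] (x : S) (n : ℕ) :
    ∃ z, (1 + x) ^ n = 1 + n * x + n.choose 2 * x ^ 2 + x ^ 3 * z := by
  induction n with
  | zero => exact ⟨0, by simp⟩
  | succ n ih =>
    obtain ⟨z, hz⟩ := ih
    refine ⟨n.choose 2 + z + x * z, ?_⟩
    rw [pow_succ, hz, Nat.choose_succ_succ' n 1, Nat.choose_one_right]
    push_cast
    ring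

theorem exists_eq_prime_mul_of_pow_eq_one {S : Type*} [CommRing S] [IsAddTorsionFree S] {ℓ p : ℕ}
    (hℓ : ℓ.Prime) (hℓ2 : ℓ ≠ 2) (hp : p.Prime) {h : S} (hpow : (1 + ℓ * h) ^ p = 1) :
    ∃ y, h = ℓ * (h * y) := by
  have cancel : ∀ {x : S}, (ℓ : S) * x = 0 → x = 0 := fun {x} hx =>
    (smul_eq_zero_iff_right hℓ.ne_zero).1 ((nsmul_eq_mul ℓ x).trans hx)
  obtain ⟨z, hz⟩ := exists_one_add_pow_eq (ℓ * h) p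
  have hsum : p * h + ℓ * p.choose 2 * h ^ 2 + ℓ ^ 2 * h ^ 3 * z = 0 :=
    cancel (by linear_combination hpow - hz)
  rcases eq_or_ne p ℓ with rfl | hne
  · obtain ⟨c, hc⟩ : p ∣ p.choose 2 :=
      hp.dvd_choose_self two_ne_zero (hp.two_le.lt_of_ne' hℓ2)
    have hsum' : h + p * c * h ^ 2 + p * h ^ 3 * z = 0 :=
      cancel (by rw [hc] at hsum; push_cast at hsum; linear_combination hsum)
    exact ⟨-(c * h + h ^ 2 * z), by linear_combination hsum'⟩
  · obtain ⟨s, t, hst⟩ : IsCoprime (p : ℤ) ℓ :=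
      Nat.isCoprime_iff_coprime.2 ((Nat.coprime_primes hp hℓ).2 hne)
    have hst' : (s : S) * p + t * ℓ = 1 := by exact_mod_cast congrArg (Int.cast : ℤ → S) hst
    exact ⟨t - s * (p.choose 2 * h + ℓ * h ^ 2 * z), by linear_combination s * hsum - h * hst'⟩

theorem eq_zero_of_eq_prime_mul {S : Type*} [CommRing S] [IsAddTorsionFree S] [Module.Finite ℤ S]
    {ℓ : ℕ} (hℓ : ℓ.Prime) {h y : S} (hy : h = ℓ * (h * y)) : h = 0 := by
  have hpow : ∀ n : ℕ, h = ((ℓ : ℤ) ^ n) • (h * y ^ n) := by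
    intro n
    induction n with
    | zero => simp
    | succ n ih =>
      calc h = ((ℓ : ℤ) ^ n) • ((ℓ * (h * y)) * y ^ n) := by rwa [← hy]
        _ = ((ℓ : ℤ) ^ (n + 1)) • (h * y ^ (n + 1)) := by
          simp only [zsmul_eq_mul]
          push_cast
          ring
  have hI : Ideal.span {(ℓ : ℤ)} ≠ ⊤ := by
    rw [Ne, Ideal.span_singleton_eq_top, Int.isUnit_iff_natAbs_eq]
    exact hℓ.ne_one
  have : Module.IsTorsionFree ℤ S := Module.isTorsionFree_int_iff_isAddTorsionFree.2 inferInstance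
  rw [← Submodule.mem_bot ℤ, ← Ideal.iInf_pow_smul_eq_bot_of_isTorsionFree (M := S) _ hI,
    Submodule.mem_iInf]
  intro n
  rw [hpow n]
  exact Submodule.smul_mem_smul (Ideal.pow_mem_pow (Ideal.mem_span_singleton_self _) n) trivial

section Minkowski

variable {R : Type*} [Ring R] [Module.Finite ℤ R] [IsAddTorsionFree R] {ℓ : ℕ}

open scoped IsMulCommutative in
theorem eq_zero_of_one_add_prime_mul_pow_eq_one {p : ℕ} (hℓ : ℓ.Prime) (hℓ2 : ℓ ≠ 2)
    (hp : p.Prime) {h : R} (hpow : (1 + ℓ * h) ^ p = 1) : h = 0 := by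
  let S := Algebra.adjoin ℤ {h}
  have : IsAddTorsionFree S := Subtype.val_injective.isAddTorsionFree S.val.toAddMonoidHom
  have : Module.Finite ℤ S := inferInstanceAs (Module.Finite ℤ S.toSubmodule)
  let x : S := ⟨h, Algebra.self_mem_adjoin_singleton ℤ h⟩
  have hx : (1 + ℓ * x) ^ p = 1 := Subtype.ext (by simpa [x] using hpow)
  obtain ⟨y, hy⟩ := exists_eq_prime_mul_of_pow_eq_one hℓ hℓ2 hp hx
  exact congrArg Subtype.val (eq_zero_of_eq_prime_mul hℓ hy)

theorem eq_one_of_pow_eq_one_of_prime_dvd_sub_one (hℓ : ℓ.Prime) (hℓ2 : ℓ ≠ 2) {g : R}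
    (hg : (ℓ : R) ∣ g - 1) {n : ℕ} (hn : n ≠ 0) (hpow : g ^ n = 1) : g = 1 := by
  induction n using Nat.recOnMul generalizing g with
  | zero => exact absurd rfl hn
  | one => simpa using hpow
  | prime p hp =>
    obtain ⟨h, hh⟩ := hg
    obtain rfl : g = 1 + ℓ * h := by rw [← hh, add_sub_cancel]
    rw [eq_zero_of_one_add_prime_mul_pow_eq_one hℓ hℓ2 hp hpow, mul_zero, add_zero]
  | mul a b iha ihb =>
    have hga : (ℓ : R) ∣ g ^ a - 1 :=
      hg.trans (by simpa using (Commute.one_right g).sub_dvd_pow_sub_pow a)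
    exact iha hg (left_ne_zero_of_mul hn)
      (ihb hga (right_ne_zero_of_mul hn) (by rwa [← pow_mul]))

variable (R) in
theorem hasBoundedFiniteSubgroups_units : HasBoundedFiniteSubgroups Rˣ := by
  let I : Ideal R := Ideal.span {((3 : ℕ) : R)}
  have hI : ∀ x, x ∈ I ↔ ((3 : ℕ) : R) ∣ x := fun x => by
    simp only [I, Ideal.mem_span_singleton', Dvd.dvd, (Nat.cast_commute 3 _).eq, eq_comm]
  have : I.IsTwoSided := ⟨fun {a} b ha => (hI _).2 (((hI a).1 ha).mul_right b)⟩
  have : Module.Finite ℤ (R ⧸ I) := .of_surjective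
    (Ideal.Quotient.mk I).toAddMonoidHom.toIntLinearMap Ideal.Quotient.mk_surjective
  have : Finite (R ⧸ I) := Module.finite_of_fg_torsion _ fun {x} => by
    obtain ⟨r, rfl⟩ := Ideal.Quotient.mk_surjective x
    refine ⟨⟨3, by simp⟩, Ideal.Quotient.eq_zero_iff_mem.2 ((hI _).2 ⟨r, ?_⟩)⟩
    simp
  refine HasBoundedFiniteSubgroups.of_finite.of_ker_torsionFree
    (Units.map (Ideal.Quotient.mk I).toMonoidHom) fun g hg hfin => Units.ext ?_
  obtain ⟨n, hn, hpow⟩ := isOfFinOrder_iff_pow_eq_one.1 hfin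
  have hg' : ((3 : ℕ) : R) ∣ g - 1 :=
    (hI _).1 ((Ideal.Quotient.mk_eq_mk_iff_sub_mem _ _).1 (congrArg Units.val hg))
  exact eq_one_of_pow_eq_one_of_prime_dvd_sub_one Nat.prime_three (by decide) hg' hn.ne'
    (congrArg Units.val hpow)

end Minkowski

/-! ### Rosenlicht's theorem -/

theorem fg_quotient_of_ker_le {G H : Type*} [CommGroup G] [CommGroup H] [Group.FG H] (f : G →* H)
    {N : Subgroup G} (hN : f.ker ≤ N) : Group.FG (G ⧸ N) := by
  have : Module.Finite ℤ (Additive H) := Module.Finite.iff_addGroup_fg.2 inferInstance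
  have : Group.FG f.range := by
    have : Module.Finite ℤ (LinearMap.range f.toAdditive.toIntLinearMap) := inferInstance
    exact GroupFG.iff_add_fg.2 (Module.Finite.iff_addGroup_fg.1 this)
  have : Group.FG (G ⧸ f.ker) :=
    Group.fg_of_surjective (f := (QuotientGroup.quotientKerEquivRange f).symm.toMonoidHom)
      (QuotientGroup.quotientKerEquivRange f).symm.surjective
  exact Group.fg_of_surjective (f := QuotientGroup.map _ N (.id G) hN)
    (QuotientGroup.map_surjective_of_surjective _ N (.id G) (QuotientGroup.mk'_surjective N) hN)

/-- The units `u` of an `R`-algebra such that both `u` and `u⁻¹` are integral over `R`. Over a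
field `R` they play the role of the constant units. -/
def integralUnits (R A : Type*) [CommRing R] [CommRing A] [Algebra R A] : Subgroup Aˣ :=
  (integralClosure R A).toSubmonoid.units

section

variable {R A : Type*} [CommRing R] [CommRing A] [Algebra R A]

theorem mem_integralUnits {u : Aˣ} :
    u ∈ integralUnits R A ↔ IsIntegral R (u : A) ∧ IsIntegral R (↑u⁻¹ : A) :=
  Iff.rfl

theorem fg_units_quotient_of_map {S B : Type*} [CommRing S] [CommRing B] [Algebra S B]
    [Group.FG (Bˣ ⧸ integralUnits S B)] (φ : A →* B)
    (hφ : ∀ x, IsIntegral S (φ x) → IsIntegral R x) : Group.FG (Aˣ ⧸ integralUnits R A) :=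
  fg_quotient_of_ker_le (H := Bˣ ⧸ integralUnits S B)
      ((QuotientGroup.mk' _).comp (Units.map φ)) fun u hu => by
    have h : Units.map φ u ∈ integralUnits S B := (QuotientGroup.eq_one_iff _).1 hu
    exact ⟨hφ _ h.1, hφ _ h.2⟩

end

section

open IsDedekindDomain

theorem finite_heightOneSpectrum_of_finite (O C : Type*) [CommRing O] [IsDomain O]
    [IsDiscreteValuationRing O] [CommRing C] [IsDomain C] [Algebra O C] [Module.Finite O C]
    [FaithfulSMul O C] : Finite (HeightOneSpectrum C) := by
  have := (Algebra.QuasiFinite.finite_primesOver (S := C) (IsLocalRing.maximalIdeal O)).to_subtype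
  refine Finite.of_injective (β := (IsLocalRing.maximalIdeal O).primesOver C)
    (fun v => ⟨v.asIdeal, v.isPrime, ⟨?_⟩⟩) fun v w h => HeightOneSpectrum.ext (congrArg (·.1) h)
  have hne : v.asIdeal.under O ≠ ⊥ := by
    obtain ⟨x, hx, hx0⟩ := Submodule.exists_mem_ne_zero_of_ne_bot v.ne_bot
    exact Ideal.comap_ne_bot_of_integral_mem hx0 hx (Algebra.IsIntegral.isIntegral x)
  exact (IsLocalRing.eq_maximalIdeal
    (Ring.DimensionLEOne.maximalOfPrime hne (v.isPrime.under O))).symm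

theorem mem_range_algebraMap_of_valuationOfNeZero_eq_one {C L : Type*} [CommRing C]
    [IsDedekindDomain C] [Field L] [Algebra C L] [IsFractionRing C L] {u : Lˣ}
    (hu : ∀ v : HeightOneSpectrum C, v.valuationOfNeZero u = 1) :
    (u : L) ∈ (algebraMap C L).range :=
  HeightOneSpectrum.mem_integers_of_valuation_le_one L (u : L) fun v => by
    rw [← HeightOneSpectrum.valuationOfNeZero_eq, hu v, WithZero.coe_one]

variable (O F L : Type*) [CommRing O] [IsDomain O] [IsDiscreteValuationRing O] [Field F]
  [Algebra O F] [IsFractionRing O F] [Field L] [Algebra F L] [Algebra O L] [IsScalarTower O F L]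
  [FiniteDimensional F L]

include F

theorem fg_units_quotient_of_isSeparable [Algebra.IsSeparable F L] :
    Group.FG (Lˣ ⧸ integralUnits O L) := by
  have : FaithfulSMul O L := .trans O F L
  let C := integralClosure O L
  have : IsDedekindDomain C := integralClosure.isDedekindDomain O F L
  have : IsFractionRing C L := integralClosure.isFractionRing_of_finite_extension F L
  have : Module.Finite O C := IsIntegralClosure.finite O F L C
  have := finite_heightOneSpectrum_of_finite O C
  let f : Lˣ →* (HeightOneSpectrum C → Multiplicative ℤ) :=
    MonoidHom.pi fun v => v.valuationOfNeZero
  have hf : ∀ u ∈ f.ker, IsIntegral O (u : L) := fun u hu => by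
    obtain ⟨c, hc⟩ := mem_range_algebraMap_of_valuationOfNeZero_eq_one (congrFun hu)
    exact hc ▸ c.2
  exact fg_quotient_of_ker_le f fun u hu => ⟨hf u hu, hf u⁻¹ (inv_mem hu)⟩

theorem fg_units_quotient_of_isDiscreteValuationRing : Group.FG (Lˣ ⧸ integralUnits O L) := by
  let M := separableClosure F L
  let p := ringExpChar F
  have : ExpChar M p := expChar_of_injective_algebraMap (algebraMap F M).injective p
  have : IsScalarTower O M L := .of_algebraMap_eq fun _ => rfl
  have := fg_units_quotient_of_isSeparable O F M
  refine fg_units_quotient_of_map (S := O)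
    (IsPurelyInseparable.iterateFrobenius M L p le_rfl).toMonoidHom fun x hx =>
      IsIntegral.of_pow (expChar_pow_pos M p (IsPurelyInseparable.exponent M L)) ?_
  rw [← IsPurelyInseparable.algebraMap_iterateFrobenius M p le_rfl]
  exact hx.algebraMap

end

section

open scoped WithZero nonZeroDivisors

open scoped Classical in
/-- The total degree as a valuation on a polynomial ring: geometrically, the order of the pole along
the hyperplane at infinity. The zero polynomial, whose `totalDegree` is `0`, has value `0`. -/
noncomputable def totalDegreeValuation (σ R : Type*) [CommRing R] [IsDomain R] :
    Valuation (MvPolynomial σ R) ℤᵐ⁰ where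
  toFun f := if f = 0 then 0 else WithZero.exp (f.totalDegree : ℤ)
  map_zero' := if_pos rfl
  map_one' := by simp
  map_mul' f g := by
    by_cases hf : f = 0
    · simp [hf]
    by_cases hg : g = 0
    · simp [hg]
    simp [hf, hg, MvPolynomial.totalDegree_mul_of_isDomain hf hg]
  map_add_le_max' f g := by
    by_cases hf : f = 0
    · simp [hf]
    by_cases hg : g = 0
    · simp [hg]
    by_cases hfg : f + g = 0
    · simp [hfg]
    simp only [hf, hg, hfg, if_false, le_max_iff, WithZero.exp_le_exp, Nat.cast_le]
    exact le_max_iff.1 (MvPolynomial.totalDegree_add f g)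

section

variable {σ R : Type*} [CommRing R] [IsDomain R]

theorem totalDegreeValuation_apply {f : MvPolynomial σ R} (hf : f ≠ 0) :
    totalDegreeValuation σ R f = WithZero.exp (f.totalDegree : ℤ) :=
  if_neg hf

variable (σ R) in
theorem nonZeroDivisors_le_primeCompl_supp_totalDegreeValuation :
    (MvPolynomial σ R)⁰ ≤ (totalDegreeValuation σ R).supp.primeCompl := fun f hf hf' => by
  rw [SetLike.mem_coe, Valuation.mem_supp_iff,
    totalDegreeValuation_apply (nonZeroDivisors.ne_zero hf)] at hf'
  exact WithZero.exp_ne_zero hf'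

end

/-- The extension of `totalDegreeValuation` to rational functions. -/
noncomputable def valuationAtInfinity (σ R F : Type*) [CommRing R] [IsDomain R] [Field F]
    [Algebra (MvPolynomial σ R) F] [IsFractionRing (MvPolynomial σ R) F] : Valuation F ℤᵐ⁰ :=
  (totalDegreeValuation σ R).extendToLocalization
    (nonZeroDivisors_le_primeCompl_supp_totalDegreeValuation σ R) F

variable {σ R F : Type*} [CommRing R] [IsDomain R] [Field F] [Algebra (MvPolynomial σ R) F]
  [IsFractionRing (MvPolynomial σ R) F]

theorem valuationAtInfinity_algebraMap (f : MvPolynomial σ R) :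
    valuationAtInfinity σ R F (algebraMap _ F f) = totalDegreeValuation σ R f :=
  Valuation.extendToLocalization_apply_map_apply ..

theorem mem_range_algebraMap_of_valuationAtInfinity_le_one {f : MvPolynomial σ R}
    (hf : valuationAtInfinity σ R F (algebraMap _ F f) ≤ 1) :
    f ∈ (algebraMap R (MvPolynomial σ R)).range := by
  by_cases h0 : f = 0
  · exact h0 ▸ zero_mem _
  rw [valuationAtInfinity_algebraMap, totalDegreeValuation_apply h0, ← WithZero.exp_zero,
    WithZero.exp_le_exp, Nat.cast_nonpos] at hf
  exact ⟨_, (MvPolynomial.totalDegree_eq_zero_iff_eq_C.1 hf).symm⟩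

theorem isDiscreteValuationRing_valuationAtInfinity [Nonempty σ] :
    IsDiscreteValuationRing (valuationAtInfinity σ R F).valuationSubring := by
  let v := valuationAtInfinity σ R F
  have : IsCyclic (MonoidWithZeroHom.valueGroup (.ofClass v)) := inferInstance
  have : Nontrivial (MonoidWithZeroHom.valueGroup (.ofClass v)) := by
    obtain ⟨i⟩ := ‹Nonempty σ›
    have hX : v (algebraMap (MvPolynomial σ R) F (MvPolynomial.X i)) = WithZero.exp (1 : ℤ) := by
      rw [valuationAtInfinity_algebraMap, totalDegreeValuation_apply (MvPolynomial.X_ne_zero i),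
        MvPolynomial.totalDegree_X, Nat.cast_one]
    refine Subgroup.nontrivial_iff_exists_ne_one _ |>.2
      ⟨Units.mk0 (WithZero.exp (1 : ℤ)) WithZero.exp_ne_zero,
        Subgroup.subset_closure ⟨_, hX⟩, fun h => ?_⟩
    simpa using congrArg Units.val h
  exact Valuation.valuationSubring_isDiscreteValuationRing v

end

/-- The minimal polynomial of `x` over `F` has coefficients in both `P` and `O`. -/
theorem isIntegral_of_isIntegral_of_isIntegral {R P O F L : Type*} [CommRing R] [CommRing P]
    [IsDomain P] [IsIntegrallyClosed P] [CommRing O] [IsDomain O] [IsIntegrallyClosed O] [Field F]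
    [Field L] [Algebra R P] [Algebra P F] [IsFractionRing P F] [Algebra O F] [IsFractionRing O F]
    [Algebra F L] [Algebra P L] [IsScalarTower P F L] [Algebra O L] [IsScalarTower O F L]
    [Algebra R L] [IsScalarTower R P L]
    (hR : ∀ a : P, algebraMap P F a ∈ (algebraMap O F).range → a ∈ (algebraMap R P).range)
    {x : L} (hP : IsIntegral P x) (hO : IsIntegral O x) : IsIntegral R x := by
  have hmin : (minpoly P x).map (algebraMap P F) = (minpoly O x).map (algebraMap O F) :=
    (minpoly.isIntegrallyClosed_eq_field_fractions' F hP).symm.trans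
      (minpoly.isIntegrallyClosed_eq_field_fractions' F hO)
  have hlifts : minpoly P x ∈ Polynomial.lifts (algebraMap R P) :=
    (Polynomial.lifts_iff_coeff_lifts _).2 fun n => hR _ ⟨(minpoly O x).coeff n, by
      rw [← Polynomial.coeff_map, ← Polynomial.coeff_map, hmin]⟩
  obtain ⟨q, hq, -, hqm⟩ := Polynomial.lifts_and_degree_eq_and_monic hlifts (minpoly.monic hP)
  refine ⟨q, hqm, ?_⟩
  rw [← Polynomial.aeval_def, ← Polynomial.aeval_map_algebraMap P, hq, minpoly.aeval]

theorem fg_units_quotient_of_isDomain (k B : Type*) [Field k] [CommRing B] [IsDomain B]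
    [Algebra k B] [Algebra.FiniteType k B] : Group.FG (Bˣ ⧸ integralUnits k B) := by
  obtain ⟨s, g, hg, hfin⟩ := exists_finite_inj_algHom_of_fg k B
  let P := MvPolynomial (Fin s) k
  let := g.toRingHom.toAlgebra
  have : IsScalarTower k P B := .of_algebraMap_eq' g.comp_algebraMap.symm
  have : Module.Finite P B := hfin
  have : FaithfulSMul P B := (faithfulSMul_iff_algebraMap_injective P B).2 hg
  rcases isEmpty_or_nonempty (Fin s) with hs | hs
  · have : Algebra.IsIntegral k P :=
      Algebra.isIntegral_of_surjective (MvPolynomial.C_surjective (Fin s))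
    have : Algebra.IsIntegral k B := Algebra.IsIntegral.trans P
    exact fg_quotient_of_ker_le (1 : Bˣ →* Unit) fun u _ =>
      ⟨Algebra.IsIntegral.isIntegral _, Algebra.IsIntegral.isIntegral _⟩
  · let F := FractionRing P
    let L := FractionRing B
    let := FractionRing.liftAlgebra P L
    have := FractionRing.isScalarTower_liftAlgebra P L
    let O := (valuationAtInfinity (Fin s) k F).valuationSubring
    have : IsDiscreteValuationRing O := isDiscreteValuationRing_valuationAtInfinity
    have hconst : ∀ a : P, algebraMap P F a ∈ (algebraMap O F).range → a ∈ (algebraMap k P).range :=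
      fun a ⟨b, hb⟩ => mem_range_algebraMap_of_valuationAtInfinity_le_one (F := F) (hb ▸ b.2)
    have := fg_units_quotient_of_isDiscreteValuationRing O F L
    refine fg_units_quotient_of_map (S := O) (algebraMap B L).toMonoidHom fun x hx => ?_
    have hP : IsIntegral P (algebraMap B L x) := (Algebra.IsIntegral.isIntegral x).algebraMap
    exact (isIntegral_algebraMap_iff (IsFractionRing.injective B L)).1
      (isIntegral_of_isIntegral_of_isIntegral hconst hP hx)

section

variable {R A : Type*} [CommRing R] [CommRing A] [Algebra R A]

theorem eq_of_forall_minimalPrimes_quotient_mk_eq [_root_.IsReduced A] {x y : A}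
    (h : ∀ p ∈ minimalPrimes A, Ideal.Quotient.mk p x = Ideal.Quotient.mk p y) : x = y := by
  have hmem : x - y ∈ sInf (minimalPrimes A) :=
    (Submodule.mem_sInf).2 fun p hp => (Ideal.Quotient.mk_eq_mk_iff_sub_mem x y).1 (h p hp)
  rw [minimalPrimes, Ideal.sInf_minimalPrimes] at hmem
  exact sub_eq_zero.1 (mem_nilradical.1 hmem).eq_zero

theorem isIntegral_of_forall_minimalPrimes [_root_.IsReduced A] [Finite (minimalPrimes A)] {x : A}
    (h : ∀ p : minimalPrimes A, IsIntegral R (Ideal.Quotient.mk p.1 x)) : IsIntegral R x := by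
  choose q hq hqx using h
  have := Fintype.ofFinite (minimalPrimes A)
  refine ⟨∏ p, q p, Polynomial.monic_prod_of_monic _ _ fun p _ => hq p,
    eq_of_forall_minimalPrimes_quotient_mk_eq fun p hp => ?_⟩
  rw [Polynomial.eval₂_finsetProd, map_prod, map_zero]
  refine Finset.prod_eq_zero (Finset.mem_univ ⟨p, hp⟩) ?_
  rw [Polynomial.hom_eval₂]
  exact hqx ⟨p, hp⟩

variable (R A) in
theorem isMulTorsionFree_units_quotient : IsMulTorsionFree (Aˣ ⧸ integralUnits R A) := by
  refine ⟨fun n hn => (injective_iff_map_eq_one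
    (powMonoidHom (α := Aˣ ⧸ integralUnits R A) n)).2 fun x hx => ?_⟩
  obtain ⟨u, rfl⟩ := QuotientGroup.mk_surjective x
  obtain ⟨hu, hu'⟩ := mem_integralUnits.1 ((QuotientGroup.eq_one_iff (u ^ n)).1 hx)
  rw [← inv_pow] at hu'
  exact (QuotientGroup.eq_one_iff u).2 ⟨hu.of_pow hn.pos, hu'.of_pow hn.pos⟩

end

section

variable (k : Type*) [Field k]

theorem finite_integralClosure_of_isDomain (B : Type*) [CommRing B] [IsDomain B] [Algebra k B]
    [Algebra.FiniteType k B] : Module.Finite k (integralClosure k B) := by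
  obtain ⟨m, hm⟩ := Ideal.exists_maximal B
  let := Ideal.Quotient.field m
  have : Module.Finite k (B ⧸ m) := finite_of_finite_type_of_isJacobsonRing k (B ⧸ m)
  let : Field (integralClosure k B) :=
    (isField_of_isIntegral_of_isField' (Field.toIsField k)).toField
  exact Module.Finite.of_injective
    ((Ideal.Quotient.mkₐ k m).comp (integralClosure k B).val).toLinearMap
    (RingHom.injective ((Ideal.Quotient.mk m).comp (integralClosure k B).val.toRingHom))

variable (A : Type*) [CommRing A] [Algebra k A] [Algebra.FiniteType k A]

include k in
theorem finite_minimalPrimes : Finite (minimalPrimes A) :=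
  have := Algebra.FiniteType.isNoetherianRing k A
  (minimalPrimes.finite_of_isNoetherianRing A).to_subtype

variable [_root_.IsReduced A]

theorem fg_units_quotient : Group.FG (Aˣ ⧸ integralUnits k A) := by
  have := finite_minimalPrimes k A
  have (p : minimalPrimes A) : p.1.IsPrime := p.2.1.1
  have (p : minimalPrimes A) := fg_units_quotient_of_isDomain k (A ⧸ p.1)
  let f : Aˣ →* ∀ p : minimalPrimes A, (A ⧸ p.1)ˣ ⧸ integralUnits k (A ⧸ p.1) :=
    MonoidHom.pi fun p =>
      (QuotientGroup.mk' _).comp (Units.map (Ideal.Quotient.mk p.1).toMonoidHom)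
  refine fg_quotient_of_ker_le
    (H := ∀ p : minimalPrimes A, (A ⧸ p.1)ˣ ⧸ integralUnits k (A ⧸ p.1)) f fun u hu => ?_
  have h (p : minimalPrimes A) :=
    mem_integralUnits.1 ((QuotientGroup.eq_one_iff _).1 (congrFun hu p))
  exact ⟨isIntegral_of_forall_minimalPrimes fun p => (h p).1,
    isIntegral_of_forall_minimalPrimes fun p => (h p).2⟩

theorem finite_integralClosure : Module.Finite k (integralClosure k A) := by
  have := finite_minimalPrimes k A
  have (p : minimalPrimes A) : p.1.IsPrime := p.2.1.1
  have (p : minimalPrimes A) := finite_integralClosure_of_isDomain k (A ⧸ p.1)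
  refine Module.Finite.of_injective (LinearMap.pi fun p : minimalPrimes A =>
    (Ideal.Quotient.mkₐ k p.1).mapIntegralClosure.toLinearMap) fun x y h => Subtype.ext ?_
  exact eq_of_forall_minimalPrimes_quotient_mk_eq fun p hp =>
    congrArg Subtype.val (congrFun h ⟨p, hp⟩)

theorem finite_algEquiv_integralClosure :
    Finite (integralClosure k A ≃ₐ[k] integralClosure k A) := by
  have := finite_minimalPrimes k A
  have := finite_integralClosure k A
  have (p : minimalPrimes A) : p.1.IsPrime := p.2.1.1
  let f (σ : integralClosure k A ≃ₐ[k] integralClosure k A) (p : minimalPrimes A) :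
      integralClosure k A →ₐ[k] A ⧸ p.1 :=
    ((Ideal.Quotient.mkₐ k p.1).comp (integralClosure k A).val).comp σ
  refine Finite.of_injective f fun σ τ h => AlgEquiv.ext fun x => Subtype.ext ?_
  exact eq_of_forall_minimalPrimes_quotient_mk_eq fun p hp =>
    DFunLike.congr_fun (congrFun h ⟨p, hp⟩) x

end

/-! ### Automorphisms of algebras generated by units -/

theorem hasBoundedFiniteSubgroups_mulAut (M : Type*) [CommGroup M] [Group.FG M]
    [IsMulTorsionFree M] : HasBoundedFiniteSubgroups (MulAut M) := by
  have : Module.Finite ℤ (Additive M) := Module.Finite.iff_addGroup_fg.2 inferInstance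
  have : Module.IsTorsionFree ℤ (Additive M) :=
    Module.isTorsionFree_int_iff_isAddTorsionFree.2 inferInstance
  have : Module.Free ℤ (Additive M) := Module.free_of_finite_type_torsion_free'
  have : IsAddTorsionFree (Module.End ℤ (Additive M)) :=
    Module.isTorsionFree_int_iff_isAddTorsionFree.1 inferInstance
  let f : MulAut M →* Module.End ℤ (Additive M) :=
    { toFun := fun σ => σ.toMonoidHom.toAdditive.toIntLinearMap
      map_one' := rfl
      map_mul' := fun _ _ => rfl }
  refine (hasBoundedFiniteSubgroups_units (Module.End ℤ (Additive M))).of_ker_torsionFree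
    f.toHomUnits fun σ hσ _ => MulEquiv.ext fun x => ?_
  exact DFunLike.congr_fun (congrArg Units.val hσ) (Additive.ofMul x)

section

variable (R A : Type*) [CommRing R] [CommRing A] [Algebra R A]

/-- The action of the automorphisms of an algebra on its integral elements. -/
def integralClosureAut : (A ≃ₐ[R] A) →* (integralClosure R A ≃ₐ[R] integralClosure R A) where
  toFun σ := σ.mapIntegralClosure
  map_one' := rfl
  map_mul' _ _ := rfl

/-- The action of the automorphisms of an algebra on its units modulo the integral ones. -/
def unitsQuotientAut : (A ≃ₐ[R] A) →* MulAut (Aˣ ⧸ integralUnits R A) where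
  toFun σ := QuotientGroup.congr _ _ (Units.mapEquiv σ) <| by
    ext u
    exact Subgroup.mem_map_equiv.trans
      (and_congr (isIntegral_algEquiv σ.symm) (isIntegral_algEquiv σ.symm))
  map_one' := by ext ⟨u⟩; rfl
  map_mul' σ τ := by ext ⟨u⟩; rfl

variable {R A}

theorem exists_apply_eq_mul_of_unitsQuotientAut_eq_one {σ : A ≃ₐ[R] A}
    (hσ : unitsQuotientAut R A σ = 1) (u : Aˣ) :
    ∃ c : integralClosure R A, σ u = c * u := by
  have h : (Units.mapEquiv (σ : A ≃* A) u : Aˣ ⧸ integralUnits R A) = u :=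
    DFunLike.congr_fun hσ (u : Aˣ ⧸ integralUnits R A)
  have hc : IsIntegral R (↑(Units.mapEquiv (σ : A ≃* A) u / u) : A) :=
    (mem_integralUnits.1 ((QuotientGroup.eq_iff_div_mem).1 h)).1
  exact ⟨⟨_, hc⟩, congrArg Units.val (div_mul_cancel (Units.mapEquiv (σ : A ≃* A) u) u).symm⟩

theorem mul_comm_of_integralClosureAut_eq_one (hA : Algebra.adjoin R {x : A | IsUnit x} = ⊤)
    {σ τ : A ≃ₐ[R] A} (hσ : integralClosureAut R A σ = 1) (hτ : integralClosureAut R A τ = 1)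
    (hσ' : unitsQuotientAut R A σ = 1) (hτ' : unitsQuotientAut R A τ = 1) : σ * τ = τ * σ := by
  have hfix {ρ : A ≃ₐ[R] A} (hρ : integralClosureAut R A ρ = 1) (c : integralClosure R A) :
      ρ c = c :=
    congrArg Subtype.val (DFunLike.congr_fun hρ c)
  refine AlgEquiv.coe_toAlgHom_injective (AlgHom.ext_of_adjoin_eq_top hA ?_)
  rintro _ ⟨u, rfl⟩
  obtain ⟨s, hs⟩ := exists_apply_eq_mul_of_unitsQuotientAut_eq_one hσ' u
  obtain ⟨t, ht⟩ := exists_apply_eq_mul_of_unitsQuotientAut_eq_one hτ' u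
  calc
    σ (τ u) = t * (s * u) := by rw [ht, map_mul, hfix hσ, hs]
    _ = s * (t * u) := mul_left_comm ..
    _ = τ (σ u) := by rw [hs, map_mul, hfix hτ, ht]

theorem isJordanGroup_algEquiv {k A : Type*} [Field k] [CommRing A] [Algebra k A]
    [Algebra.FiniteType k A] [_root_.IsReduced A]
    (hA : Algebra.adjoin k {x : A | IsUnit x} = ⊤) : IsJordanGroup (A ≃ₐ[k] A) := by
  have := finite_algEquiv_integralClosure k A
  have := fg_units_quotient k A
  have := isMulTorsionFree_units_quotient k A
  exact (HasBoundedFiniteSubgroups.of_finite.prod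
    (hasBoundedFiniteSubgroups_mulAut (Aˣ ⧸ integralUnits k A))).isJordanGroup_of_ker_comm
      ((integralClosureAut k A).prod (unitsQuotientAut k A)) fun σ hσ τ hτ => by
        rw [MonoidHom.ker_prod] at hσ hτ
        exact mul_comm_of_integralClosureAut_eq_one hA hσ.1 hτ.1 hσ.2 hτ.2

end

/-! ### Toral schemes -/

section

variable {R : Type*} [CommRing R]

theorem adjoin_isUnit_eq_top_of_surjective {A B : Type*} [CommRing A] [Algebra R A] [CommRing B]
    [Algebra R B] (hA : Algebra.adjoin R {x : A | IsUnit x} = ⊤) (φ : A →ₐ[R] B)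
    (hφ : Function.Surjective φ) : Algebra.adjoin R {x : B | IsUnit x} = ⊤ := by
  rw [eq_top_iff, ← (AlgHom.range_eq_top φ).2 hφ, ← Algebra.map_top, ← hA, AlgHom.map_adjoin]
  exact Algebra.adjoin_mono (Set.image_subset_iff.2 fun x hx => IsUnit.map φ hx)

theorem adjoin_isUnit_eq_top_of_isLocalization {P : Type*} [CommRing P] [Algebra R P] {s : Set P}
    (hs : Algebra.adjoin R s = ⊤) (M : Submonoid P) {L : Type*} [CommRing L] [Algebra R L]
    [Algebra P L] [IsScalarTower R P L] [IsLocalization M L]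
    (hunit : ∀ x ∈ s, IsUnit (algebraMap P L x)) : Algebra.adjoin R {x : L | IsUnit x} = ⊤ := by
  have hmem (p : P) : algebraMap P L p ∈ Algebra.adjoin R {x : L | IsUnit x} := by
    have : s ⊆ (Algebra.adjoin R {x : L | IsUnit x}).comap (IsScalarTower.toAlgHom R P L) :=
      fun x hx => Algebra.subset_adjoin (hunit x hx)
    exact Algebra.adjoin_le this (hs ▸ trivial : p ∈ Algebra.adjoin R s)
  refine eq_top_iff.2 fun y _ => ?_
  obtain ⟨p, m, rfl⟩ := IsLocalization.exists_mk'_eq M y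
  rw [IsLocalization.mk'_eq_mul_mk'_one]
  exact mul_mem (hmem p) (Algebra.subset_adjoin
    (IsUnit.of_mul_eq_one _ ((IsLocalization.mk'_spec L 1 m).trans (map_one _))))

end

theorem basicOpen_prod {Y : Scheme.{u}} {ι : Type*} (s : Finset ι) (f : ι → Γ(Y, ⊤)) :
    Y.basicOpen (∏ i ∈ s, f i) = ⨅ i ∈ s, Y.basicOpen (f i) := by
  classical
  induction s using Finset.induction_on with
  | empty => simp
  | insert a s ha ih => rw [Finset.prod_insert ha, Scheme.basicOpen_mul, ih, Finset.iInf_insert]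

theorem isLocalization_away_ι_appTop {Y : Scheme.{u}} [IsAffine Y] {f : Γ(Y, ⊤)} {U : Y.Opens}
    (hU : U = Y.basicOpen f) :
    @IsLocalization.Away _ _ f Γ(U, ⊤) _ U.ι.appTop.hom.toAlgebra :=
  (isAffineOpen_top Y).isLocalization_of_eq_basicOpen f (V := U.ι ''ᵁ ⊤) (homOfLE le_top)
    (by simpa using hU)

theorem coordTorusOpens_eq_basicOpen (k : Type u) [Field k] (n : ℕ) :
    coordTorusOpens k n = Scheme.basicOpen _ (∏ i, AffineSpace.coord (Spec (.of k)) i) := by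
  rw [basicOpen_prod]
  simp [coordTorusOpens]

section

variable {k : Type u}

/-- The `k`-algebra of global sections of a `k`-scheme. -/
noncomputable abbrev globalSections [CommRing k] (X : Over (Spec (.of k))) : CommAlgCat k :=
  ((algΓ (.of k)).obj X).unop

/-- The pullback of global sections along a morphism of `k`-schemes. -/
noncomputable abbrev globalSectionsMap [CommRing k] {X Y : Over (Spec (.of k))} (f : X ⟶ Y) :
    globalSections Y →ₐ[k] globalSections X :=
  ((algΓ (.of k)).map f).unop.hom

/-- The action of the automorphisms of a scheme over `k` on its global sections, by pullback along
the inverse. -/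
noncomputable def autToAlgEquiv [CommRing k] (X : Over (Spec (.of k))) :
    Aut X →* (globalSections X ≃ₐ[k] globalSections X) where
  toFun f := CommAlgCat.algEquivOfIso ((algΓ (.of k)).mapIso f.symm).unop
  map_one' := rfl
  map_mul' _ _ := rfl

theorem autToAlgEquiv_injective [CommRing k] (X : Over (Spec (.of k))) [IsAffine X.left] :
    Function.Injective (autToAlgEquiv X) := by
  intro f g h
  refine Iso.ext_inv (Over.OverMorphism.ext (ext_of_isAffine ?_))
  ext x
  exact DFunLike.congr_fun h x

/-- Affine space with coordinates indexed by `σ`, as a scheme over `k`. -/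
noncomputable abbrev affineSpaceOver (k : Type u) [CommRing k] (σ : Type u) :
    Over (Spec (.of k)) :=
  Over.mk (AffineSpace σ (Spec (.of k)) ↘ Spec (.of k))

/-- The coordinates of affine space over `k`, as elements of its algebra of global sections. -/
noncomputable def coordSection (k : Type u) [CommRing k] {σ : Type u} (i : σ) :
    globalSections (affineSpaceOver k σ) :=
  AffineSpace.coord (Spec (.of k)) i

theorem adjoin_range_coordSection_eq_top [CommRing k] (σ : Type u) :
    Algebra.adjoin k (Set.range (coordSection k (σ := σ))) = ⊤ := by
  rw [Algebra.adjoin_range_eq_range_aeval, AlgHom.range_eq_top]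
  have hsurj : Function.Surjective (AffineSpace.SpecIso σ (.of k)).hom.appTop :=
    (Scheme.Γ.mapIso (AffineSpace.SpecIso σ (.of k)).op).commRingCatIsoToRingEquiv.surjective
  rw [AffineSpace.SpecIso_hom_appTop] at hsurj
  exact fun a => (hsurj a).imp' _ fun _ hp => hp

theorem adjoin_isUnit_globalSections_coordTorus [Field k] (n : ℕ) :
    Algebra.adjoin k {x : globalSections (coordTorus k n) | IsUnit x} = ⊤ := by
  let σ := ULift.{u} (Fin n)
  let ι : coordTorus k n ⟶ affineSpaceOver k σ := Over.homMk (coordTorusOpens k n).ι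
  algebraize [(globalSectionsMap ι).toRingHom]
  have : IsLocalization.Away (∏ i : σ, coordSection k i) (globalSections (coordTorus k n)) :=
    isLocalization_away_ι_appTop (Y := AffineSpace σ (Spec (.of k)))
      (coordTorusOpens_eq_basicOpen k n)
  have : IsScalarTower k (globalSections (affineSpaceOver k σ)) (globalSections (coordTorus k n)) :=
    .of_algHom (globalSectionsMap ι)
  refine adjoin_isUnit_eq_top_of_isLocalization (adjoin_range_coordSection_eq_top σ)
    (Submonoid.powers (∏ i : σ, coordSection k i)) ?_
  rintro _ ⟨i, rfl⟩
  exact isUnit_of_dvd_unit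
    (map_dvd _ (Finset.dvd_prod_of_mem (coordSection k) (Finset.mem_univ i)))
    (IsLocalization.Away.algebraMap_isUnit _)

theorem finiteType_globalSections [CommRing k] (X : Over (Spec (.of k))) [IsAffine X.left]
    [LocallyOfFiniteType X.hom] : Algebra.FiniteType k (globalSections X) :=
  (HasRingHomProperty.appTop @LocallyOfFiniteType X.hom inferInstance).comp
    (.of_surjective _ (Scheme.ΓSpecIso (.of k)).symm.commRingCatIsoToRingEquiv.surjective)

theorem isAffineOpen_coordTorusOpens [Field k] (n : ℕ) : IsAffineOpen (coordTorusOpens k n) := by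
  rw [coordTorusOpens_eq_basicOpen]
  exact (isAffineOpen_top _).basicOpen _

end

theorem theorem2p16_general (k : Type u) [Field k] (X : Over (Spec (CommRingCat.of k)))
    [AlgebraicGeometry.IsReduced X.left] (hT : IsToral k X) : IsJordanGroup (Aut X) := by
  obtain ⟨n, i, _⟩ := hT
  have : IsAffine (coordTorus k n).left := isAffineOpen_coordTorusOpens n
  obtain ⟨_, hi⟩ := IsClosedImmersion.isAffine_surjective_of_isAffine i.left
  have hgen := adjoin_isUnit_eq_top_of_surjective (adjoin_isUnit_globalSections_coordTorus n)
    (globalSectionsMap i) hi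
  have : LocallyOfFiniteType (coordTorus k n).hom :=
    inferInstanceAs (LocallyOfFiniteType ((coordTorusOpens k n).ι ≫ _ ↘ _))
  have : LocallyOfFiniteType X.hom :=
    Over.w i ▸ inferInstanceAs (LocallyOfFiniteType (i.left ≫ (coordTorus k n).hom))
  have := finiteType_globalSections X
  have : _root_.IsReduced (globalSections X) := inferInstanceAs (_root_.IsReduced Γ(X.left, ⊤))
  exact (isJordanGroup_algEquiv hgen).of_injective (autToAlgEquiv X) (autToAlgEquiv_injective X)

theorem theorem2p16 (k : Type u) [Field k] [IsAlgClosed k] [CharZero k]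
    (X : Over (Spec (CommRingCat.of k))) (hX : IsVarietyOver k X) (hT : IsToral k X) :
    IsJordanGroup (Aut X) :=
  have := hX.isReduced
  theorem2p16_general k X hT
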